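/- For integers $a,b$ let ${a \brack b}_q=\frac{(q)_a}{(q)_b\,(q)_{a-b}}$ if $b\ge 0$ and $a-b\ge 0$, and ${a\brack b}_q=0$ otherwise, where $(q)_m=\prod_{j=1}^{m}(1-q^j)$. For $N,M\in\mathbb Z$, $K\in\mathbb Z_{>0}$ and rational $\alpha,\beta$ put $$G(N,M,\alpha,\beta,K,q)=\sum_{j=-\infty}^{\infty}(-1)^j q^{Kj\frac{(\alpha+\beta)j+(\alpha-\beta)}{2}}{N+M\brack N-Kj}_q ,$$ a finite sum. Write $P(q)\ge 0$ if $P$ is a polynomial in $q$ all of whose coefficients are non-negative. **Theorem.** For all integers $L\ge 0$, $n\ge 1$, $v\ge 2$ and $0\le\Delta<v$, $$G\Bigl(L-\Delta 2^{n-1},\;L+\Delta 2^{n-1},\;2\,\tfrac{2^n-2^{-n}}{3}(v+\Delta)+2^{-n},\;2\,\tfrac{2^n-2^{-n}}{3}(v-\Delta)+2^{-n},\;2^n v,\;q\Bigr)\ \ge\ 0 .$$ -/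

import Mathlib

namespace BressoudG

open Polynomial

/-- `(q)_n = (q;q)_n = ∏_{j=1}^{n} (1 - q^j)`, as a polynomial in the indeterminate `q = X`. -/
noncomputable def qPoch (n : ℕ) : ℚ[X] :=
  ∏ j ∈ Finset.range n, (1 - X ^ (j + 1))

/-- The `q`-binomial coefficient with upper entry `a` and lower entry `b`, for integers `a`, `b`:
`(q)_a / ((q)_b (q)_{a-b})` if `b ≥ 0` and `a - b ≥ 0`, and `0` otherwise.
The division in `ℚ[X]` is exact, see `qBinom_mul`. -/
noncomputable def qBinom (a b : ℤ) : ℚ[X] :=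
  if 0 ≤ b ∧ 0 ≤ a - b then
    qPoch a.toNat / (qPoch b.toNat * qPoch (a - b).toNat)
  else 0

/-- Finite sums of monomials `c q^e` with rational coefficients `c` and rational exponents `e`. -/
abbrev QExpr : Type := AddMonoidAlgebra ℚ ℚ

/-- The monomial `c q^e`. -/
noncomputable def qMonomial (e c : ℚ) : QExpr := AddMonoidAlgebra.single e c

/-- A polynomial in `q`, regarded as an expression with rational exponents. -/
noncomputable def ofPoly : ℚ[X] →ₐ[ℚ] QExpr := Polynomial.aeval (qMonomial 1 1)

/-- The `j`-th term
`(-1)^j q^{K j ((α+β) j + (α-β)) / 2} [N+M choose N-Kj]_q` of the sum defining `G`. -/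
noncomputable def GTerm (N M : ℤ) (α β : ℚ) (K : ℤ) (j : ℤ) : QExpr :=
  qMonomial ((K : ℚ) * j * (((α + β) * j + (α - β)) / 2)) ((-1) ^ j)
    * ofPoly (qBinom (N + M) (N - K * j))

/-- `G(N, M, α, β, K, q) = ∑_{j ∈ ℤ} (-1)^j q^{K j ((α+β) j + (α-β)) / 2} [N+M choose N-Kj]_q`.
For `K ≠ 0` only finitely many terms are nonzero, see `GTerm_support_finite`. -/
noncomputable def G (N M : ℤ) (α β : ℚ) (K : ℤ) : QExpr :=
  ∑ᶠ j : ℤ, GTerm N M α β K j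

/-- `P(q) ≥ 0`: `P` is a polynomial in `q` all of whose coefficients are non-negative. -/
def QNonneg (P : QExpr) : Prop :=
  ∃ p : ℚ[X], ofPoly p = P ∧ ∀ k : ℕ, 0 ≤ p.coeff k

theorem qPoch_ne_zero (n : ℕ) : qPoch n ≠ 0 := by
  unfold qPoch
  refine Finset.prod_ne_zero_iff.mpr fun j _ h => ?_
  have := congrArg (Polynomial.eval 0) h
  simp at this

theorem qPoch_dvd (s : ℕ) : ∀ a b : ℕ, a + b = s → qPoch a * qPoch b ∣ qPoch s := by
  induction s with
  | zero =>
    intro a b h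
    obtain ⟨rfl, rfl⟩ : a = 0 ∧ b = 0 := by omega
    simp [qPoch]
  | succ s ih =>
    intro a b h
    have hs : ∀ n, qPoch (n + 1) = qPoch n * (1 - X ^ (n + 1)) := fun n =>
      Finset.prod_range_succ _ _
    rcases a with _ | a
    · obtain rfl : b = s + 1 := by omega
      simp [qPoch]
    rcases b with _ | b
    · obtain rfl : a = s := by omega
      simp [qPoch]
    obtain ⟨p, hp⟩ := ih a (b + 1) (by omega)
    obtain ⟨r, hr⟩ := ih (a + 1) b (by omega)
    refine ⟨p + X ^ (a + 1) * r, ?_⟩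
    have e : s + 1 = (a + 1) + (b + 1) := by omega
    have h1 : (1 - X ^ (s + 1) : ℚ[X])
        = (1 - X ^ (a + 1)) + X ^ (a + 1) * (1 - X ^ (b + 1)) := by
      rw [e, pow_add]; ring
    rw [hs s, h1, mul_add]
    nth_rewrite 1 [hp]
    rw [hr, hs a, hs b]
    ring

/-- The division in the definition of `qBinom` is exact. -/
theorem qBinom_mul (a b : ℤ) (hb : 0 ≤ b) (hab : 0 ≤ a - b) :
    qBinom a b * (qPoch b.toNat * qPoch (a - b).toNat) = qPoch a.toNat := by
  rw [qBinom, if_pos ⟨hb, hab⟩]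
  rw [mul_comm]
  exact EuclideanDomain.mul_div_cancel'
    (mul_ne_zero (qPoch_ne_zero _) (qPoch_ne_zero _)) (qPoch_dvd _ _ _ (by omega))

/-- The sum defining `G` is a finite sum. -/
theorem GTerm_support_finite (N M : ℤ) (α β : ℚ) (K : ℤ) (hK : K ≠ 0) :
    (Function.support (GTerm N M α β K)).Finite := by
  refine (Set.finite_Icc (-(|N| + |M|)) (|N| + |M|)).subset fun j hj => ?_
  have h : 0 ≤ N - K * j ∧ 0 ≤ N + M - (N - K * j) := by
    by_contra hc
    exact hj (by rw [GTerm, qBinom, if_neg hc, map_zero, mul_zero])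
  have h1 : |K * j| ≤ |N| + |M| := by
    rw [abs_le]
    constructor
    · linarith [neg_abs_le N, neg_abs_le M, le_abs_self M, abs_nonneg N]
    · linarith [le_abs_self N, abs_nonneg M]
  have h2 : |j| ≤ |K * j| := by
    rw [abs_mul]
    exact le_mul_of_one_le_left (abs_nonneg j) (Int.one_le_abs hK)
  exact abs_le.mp (h2.trans h1)

end BressoudG

/-!
The key is an expansion with non-negative coefficients,
`q^{x² / 2} [2L choose L - x] = ∑_{k ≡ x mod 2} D_{L,k} [k choose (k - x) / 2]`, in which
`D_{L,k} = ∑_m q^{(m² + (m + k)²) / 2} (q)_L / ((q)_m (q)_k (q)_{L-m-k})` does not depend on `x`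
(`transformCoeff`, `transform`). It results from applying the `q`-Vandermonde identity to
`[2L choose L - x]` and then to one of the two factors in each term (`gaussBinom_double_eq_sum`).

Substituting it termwise into `G`, with `x = d + 2 K j`, shows that, up to a power of `q`,
`G(L - d, L + d, α / 2 + K + d, β / 2 + K - d, 2 K)` is a combination with non-negative coefficients
of the sums `G(N, M, α, β, K)` with `M - N = d` (`G_transform`). The parameters of the theorem are
those obtained from `α = β = 1`, `K = v`, `M - N = Δ` by applying this transformation `n` times
(`G_iterate_mem`).

The starting case `G(N, M, 1, 1, K)` with `|N - M| < K` follows from the two `q`-Pascal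
recurrences: they express the sums with `(α, β) = (1, 1)`, `(0, 2)`, `(2, 0)` through one another,
and the only step leaving the range of admissible `N - M` starts from a sum that vanishes by
antisymmetry (`G_mem_of_add_eq_two`).

The intermediate expressions involve half-integral and negative powers of `q`, so positivity is
proved coefficientwise in the ring of expressions with rational exponents (`nonnegCone`); that the
final expression is a polynomial is read off from its exponents (`G_iterate_mem_range`).
-/

namespace BressoudG

open Polynomial Finset

/-! ### Gaussian binomial coefficients -/

/-- The Gaussian binomial coefficient with natural entries, defined by the `q`-Pascal rule; it
vanishes when the lower entry exceeds the upper one. -/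
noncomputable def gaussBinom : ℕ → ℕ → ℚ[X]
  | _, 0 => 1
  | 0, _ + 1 => 0
  | n + 1, k + 1 => gaussBinom n k + X ^ (k + 1) * gaussBinom n (k + 1)

@[simp] theorem gaussBinom_zero_right (n : ℕ) : gaussBinom n 0 = 1 := by
  cases n <;> simp [gaussBinom]

@[simp] theorem gaussBinom_zero_succ (k : ℕ) : gaussBinom 0 (k + 1) = 0 := by
  simp [gaussBinom]

theorem gaussBinom_succ_succ (n k : ℕ) :
    gaussBinom (n + 1) (k + 1) = gaussBinom n k + X ^ (k + 1) * gaussBinom n (k + 1) := by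
  simp [gaussBinom]

theorem gaussBinom_eq_zero_of_lt {n k : ℕ} (h : n < k) : gaussBinom n k = 0 := by
  induction n generalizing k with
  | zero => obtain ⟨k, rfl⟩ := Nat.exists_eq_add_of_lt h; simp
  | succ n ih =>
    obtain ⟨k, rfl⟩ : ∃ j, k = j + 1 := ⟨k - 1, by omega⟩
    rw [gaussBinom_succ_succ, ih (by omega), ih (by omega)]; simp

theorem qPoch_succ (n : ℕ) : qPoch (n + 1) = qPoch n * (1 - X ^ (n + 1)) :=
  Finset.prod_range_succ _ _

@[simp] theorem qPoch_zero : qPoch 0 = 1 := by simp [qPoch]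

@[simp] theorem gaussBinom_self (n : ℕ) : gaussBinom n n = 1 := by
  induction n with
  | zero => simp
  | succ n ih => rw [gaussBinom_succ_succ, ih, gaussBinom_eq_zero_of_lt (by omega)]; simp

theorem gaussBinom_add_mul (k l : ℕ) :
    gaussBinom (k + l) k * (qPoch k * qPoch l) = qPoch (k + l) := by
  generalize hs : k + l = s
  induction s generalizing k l with
  | zero =>
    obtain ⟨rfl, rfl⟩ : k = 0 ∧ l = 0 := by omega
    simp
  | succ s ih =>
    rcases k with _ | k
    · obtain rfl : l = s + 1 := by omega
      simp
    rcases l with _ | l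
    · obtain rfl : k = s := by omega
      simp
    have h1 := ih k (l + 1) (by omega)
    have h2 := ih (k + 1) l (by omega)
    have e : s + 1 = (k + 1) + (l + 1) := by omega
    rw [gaussBinom_succ_succ, qPoch_succ s, e, pow_add _ (k + 1), qPoch_succ k, qPoch_succ l]
    rw [qPoch_succ] at h1 h2
    linear_combination (1 - X ^ (k + 1)) * h1 + X ^ (k + 1) * (1 - X ^ (l + 1)) * h2

theorem gaussBinom_symm (k l : ℕ) : gaussBinom (k + l) k = gaussBinom (k + l) l := by
  have h1 := gaussBinom_add_mul k l
  have h2 := gaussBinom_add_mul l k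
  rw [add_comm l k] at h2
  refine mul_right_cancel₀ (mul_ne_zero (qPoch_ne_zero k) (qPoch_ne_zero l)) ?_
  rw [h1, mul_comm (qPoch k), h2]

/-- The `q`-Vandermonde identity. The truncated difference is harmless: `gaussBinom m p.1` vanishes
where `m < p.1`. -/
theorem gaussBinom_vandermonde (m n k : ℕ) :
    gaussBinom (m + n) k =
      ∑ p ∈ antidiagonal k, X ^ (p.2 * (m - p.1)) * gaussBinom m p.1 * gaussBinom n p.2 := by
  induction m generalizing k with
  | zero =>
    cases k with
    | zero => simp
    | succ k => rw [Finset.Nat.sum_antidiagonal_succ]; simp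
  | succ m ih =>
    cases k with
    | zero => simp
    | succ k =>
      rw [show m + 1 + n = m + n + 1 by ring, gaussBinom_succ_succ, ih, ih,
        Finset.Nat.sum_antidiagonal_succ, Finset.Nat.sum_antidiagonal_succ, mul_add,
        Finset.mul_sum]
      simp only [gaussBinom_succ_succ, gaussBinom_zero_right, mul_add, add_mul,
        Finset.sum_add_distrib, Nat.add_sub_add_right, Nat.sub_zero]
      have key : ∀ p ∈ antidiagonal k,
          (X : ℚ[X]) ^ (p.2 * (m - p.1)) * (X ^ (p.1 + 1) * gaussBinom m (p.1 + 1))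
              * gaussBinom n p.2
            = X ^ (k + 1)
              * (X ^ (p.2 * (m - (p.1 + 1))) * gaussBinom m (p.1 + 1) * gaussBinom n p.2) := by
        intro p hp
        rcases lt_or_ge m (p.1 + 1) with h | h
        · simp [gaussBinom_eq_zero_of_lt h]
        · obtain ⟨d, rfl⟩ := Nat.exists_eq_add_of_le h
          rw [← mem_antidiagonal.mp hp, show p.1 + 1 + d - p.1 = d + 1 by omega,
            show p.1 + 1 + d - (p.1 + 1) = d by omega]
          ring
      rw [Finset.sum_congr rfl key]
      ring

/-- Both products equal `(q)_{a+b+c+d} / ((q)_a (q)_b (q)_c (q)_d)`. -/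
theorem gaussBinom_mul_mul (a b c d : ℕ) :
    gaussBinom (a + b + c + d) (a + b) * gaussBinom (a + b) a * gaussBinom (c + d) c
      = gaussBinom (a + b + c + d) (a + (b + c)) * gaussBinom (a + (b + c)) a
        * gaussBinom (b + c) c := by
  have h1 := gaussBinom_add_mul (a + b) (c + d)
  have h2 := gaussBinom_add_mul a b
  have h3 := gaussBinom_add_mul c d
  have h4 := gaussBinom_add_mul (a + (b + c)) d
  have h5 := gaussBinom_add_mul a (b + c)
  have h6 := gaussBinom_add_mul c b
  rw [show a + b + (c + d) = a + b + c + d by ring] at h1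
  rw [show a + (b + c) + d = a + b + c + d by ring] at h4
  rw [add_comm c b] at h6
  refine mul_right_cancel₀ (mul_ne_zero (mul_ne_zero (qPoch_ne_zero a) (qPoch_ne_zero b))
    (mul_ne_zero (qPoch_ne_zero c) (qPoch_ne_zero d))) ?_
  trans qPoch (a + b + c + d)
  · rw [← h1, ← h2, ← h3]; ring
  · rw [← h4, ← h5, ← h6]; ring

theorem gaussBinom_double (L x : ℕ) (hx : x ≤ L) :
    gaussBinom (L + L) (L - x) =
      ∑ i ∈ range (L - x + 1), X ^ (i * (i + x)) * gaussBinom L (i + x) * gaussBinom L i := by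
  rw [gaussBinom_vandermonde, ← Finset.Nat.sum_antidiagonal_swap,
    Finset.Nat.sum_antidiagonal_eq_sum_range_succ_mk]
  refine Finset.sum_congr rfl fun i hi => ?_
  have hi' : i ≤ L - x := Nat.lt_succ_iff.mp (mem_range.mp hi)
  have h := gaussBinom_symm (L - x - i) (i + x)
  rw [show L - x - i + (i + x) = L by omega] at h
  simp only [Prod.swap_prod_mk]
  rw [h, show L - (L - x - i) = i + x by omega]

/-- The `q`-Vandermonde identity for the splitting `(i + x) + d` of the upper entry. -/
theorem gaussBinom_eq_sum_split (i x d : ℕ) :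
    gaussBinom (i + x + d) i =
      ∑ t ∈ range (i + 1),
        X ^ (t * (t + x)) * gaussBinom (i + x) (i - t) * gaussBinom d t := by
  rw [gaussBinom_vandermonde, ← Finset.Nat.sum_antidiagonal_swap,
    Finset.Nat.sum_antidiagonal_eq_sum_range_succ_mk]
  refine Finset.sum_congr rfl fun t ht => ?_
  have ht' : t ≤ i := Nat.lt_succ_iff.mp (mem_range.mp ht)
  simp only [Prod.swap_prod_mk]
  rw [show i + x - (i - t) = t + x by omega]

/-- Two applications of the `q`-Vandermonde identity, the second one to a factor of the summand of
the first, followed by a regrouping of the resulting `q`-multinomial coefficient. -/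
theorem gaussBinom_double_eq_sum (L x : ℕ) (hx : x ≤ L) :
    gaussBinom (L + L) (L - x) =
      ∑ t ∈ range (L + 1), ∑ m ∈ range (L + 1),
        X ^ (m ^ 2 + m * x + 2 * m * t + 2 * t ^ 2 + 2 * t * x)
          * gaussBinom L (m + (x + 2 * t)) * gaussBinom (m + (x + 2 * t)) m
          * gaussBinom (x + 2 * t) t := by
  have vanish : ∀ t m : ℕ, L < m + (x + 2 * t) →
      (X : ℚ[X]) ^ (m ^ 2 + m * x + 2 * m * t + 2 * t ^ 2 + 2 * t * x)
          * gaussBinom L (m + (x + 2 * t)) * gaussBinom (m + (x + 2 * t)) m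
          * gaussBinom (x + 2 * t) t = 0 := by
    intro t m h
    simp [gaussBinom_eq_zero_of_lt h]
  rw [gaussBinom_double L x hx]
  have step : ∀ i ∈ range (L - x + 1),
      X ^ (i * (i + x)) * gaussBinom L (i + x) * gaussBinom L i
        = ∑ t ∈ range (i + 1),
          X ^ (i * (i + x) + t * (t + x)) * gaussBinom L (i + x) * gaussBinom (i + x) (i - t)
            * gaussBinom (L - (i + x)) t := by
    intro i hi
    have hi' : i ≤ L - x := Nat.lt_succ_iff.mp (mem_range.mp hi)
    have h := gaussBinom_eq_sum_split i x (L - (i + x))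
    rw [show i + x + (L - (i + x)) = L by omega] at h
    rw [h, Finset.mul_sum]
    refine Finset.sum_congr rfl fun t _ => ?_
    ring
  rw [Finset.sum_congr rfl step]
  -- Exchange the sums and put `i = t + m`; the terms with `L < m + x + 2 t` vanish on both sides.
  rw [Finset.sum_comm' (t' := range (L - x + 1)) (s' := fun t => Ico t (L - x + 1))
    (by intro a b; simp only [mem_range, mem_Ico]; omega)]
  rw [Finset.sum_subset (range_subset_range.mpr (by omega : L - x + 1 ≤ L + 1))
    (fun t _ ht => by
      rw [Ico_eq_empty (by simpa using ht), Finset.sum_empty])]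
  refine Finset.sum_congr rfl fun t _ => ?_
  rw [Finset.sum_Ico_eq_sum_range]
  rw [← Finset.sum_subset (range_subset_range.mpr (by omega : L - x + 1 - t ≤ L + 1))
    (fun m _ hm => vanish t m (by simp only [mem_range] at hm; omega))]
  refine Finset.sum_congr rfl fun m hm => ?_
  have hm' : t + m + x ≤ L := by have := mem_range.mp hm; omega
  rcases lt_or_ge L (m + (x + 2 * t)) with h | h
  · rw [vanish t m h, gaussBinom_eq_zero_of_lt (by omega : L - (t + m + x) < t), mul_zero]
  · obtain ⟨d, rfl⟩ := Nat.exists_eq_add_of_le h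
    have key := gaussBinom_mul_mul m (t + x) t d
    rw [show m + (t + x) + t + d = m + (x + 2 * t) + d by ring,
      show m + (t + x) = t + m + x by ring, show m + (t + x + t) = m + (x + 2 * t) by ring,
      show t + x + t = x + 2 * t by ring] at key
    rw [show m + (x + 2 * t) + d - (t + m + x) = t + d by omega,
      show t + m - t = m by omega]
    linear_combination
      X ^ (m ^ 2 + m * x + 2 * m * t + 2 * t ^ 2 + 2 * t * x) * key

/-! ### Gaussian binomials with integer entries -/

theorem qBinom_natCast (n k : ℕ) : qBinom n k = gaussBinom n k := by
  rcases lt_or_ge n k with h | h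
  · rw [gaussBinom_eq_zero_of_lt h, qBinom, if_neg (by omega)]
  · obtain ⟨l, rfl⟩ := Nat.exists_eq_add_of_le h
    have h1 := gaussBinom_add_mul k l
    have h2 := qBinom_mul (k + l : ℕ) k (by omega) (by omega)
    rw [show (((k + l : ℕ) : ℤ) - k).toNat = l by omega, Int.toNat_natCast,
      Int.toNat_natCast] at h2
    exact mul_right_cancel₀ (mul_ne_zero (qPoch_ne_zero k) (qPoch_ne_zero l)) (h2.trans h1.symm)

theorem qBinom_of_neg {a b : ℤ} (h : b < 0) : qBinom a b = 0 := by
  rw [qBinom, if_neg (by omega)]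

theorem qBinom_symm (a b : ℤ) : qBinom a (a - b) = qBinom a b := by
  unfold qBinom
  simp only [sub_sub_cancel, mul_comm, and_comm]

/-- At `a = b = 0` the rule fails, since `qBinom 0 0 = 1`. -/
theorem qBinom_pascal {a : ℤ} (ha : 1 ≤ a) (b : ℤ) :
    qBinom a b = qBinom (a - 1) (b - 1) + X ^ b.toNat * qBinom (a - 1) b := by
  rcases lt_trichotomy b 0 with h | rfl | h
  · simp [qBinom_of_neg h, qBinom_of_neg (by omega : b - 1 < 0)]
  · obtain ⟨n, rfl⟩ : ∃ n : ℕ, a = ((n + 1 : ℕ) : ℤ) := ⟨(a - 1).toNat, by omega⟩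
    have h1 := qBinom_natCast (n + 1) 0
    have h2 := qBinom_natCast n 0
    rw [show ((n + 1 : ℕ) : ℤ) - 1 = n by omega, qBinom_of_neg (by omega : (0 : ℤ) - 1 < 0)]
    simp only [Nat.cast_zero, gaussBinom_zero_right] at h1 h2
    rw [h1, h2]; simp
  · obtain ⟨n, rfl⟩ : ∃ n : ℕ, a = ((n + 1 : ℕ) : ℤ) := ⟨(a - 1).toNat, by omega⟩
    obtain ⟨k, rfl⟩ : ∃ k : ℕ, b = ((k + 1 : ℕ) : ℤ) := ⟨(b - 1).toNat, by omega⟩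
    rw [show ((n + 1 : ℕ) : ℤ) - 1 = n by omega, show ((k + 1 : ℕ) : ℤ) - 1 = k by omega,
      qBinom_natCast, qBinom_natCast, qBinom_natCast, Int.toNat_natCast, gaussBinom_succ_succ]

/-! ### Expressions with non-negative coefficients -/

theorem qMonomial_mul_qMonomial (e f c d : ℚ) :
    qMonomial e c * qMonomial f d = qMonomial (e + f) (c * d) :=
  AddMonoidAlgebra.single_mul_single _ _ _ _

theorem qMonomial_zero_one : qMonomial 0 1 = 1 := rfl

theorem ofPoly_X_pow (n : ℕ) : ofPoly (X ^ n) = qMonomial n 1 := by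
  rw [map_pow, ofPoly, aeval_X, qMonomial, AddMonoidAlgebra.single_pow]
  simp [qMonomial]

/-- The expressions all of whose coefficients are non-negative. -/
noncomputable def nonnegCone : Subsemiring QExpr where
  carrier := {P | ∀ e, 0 ≤ P.coeff e}
  zero_mem' e := by simp
  one_mem' e := by
    rw [AddMonoidAlgebra.one_def, AddMonoidAlgebra.coeff_single, Finsupp.single_apply]
    split_ifs <;> norm_num
  add_mem' hP hQ e := by
    rw [AddMonoidAlgebra.coeff_add, Finsupp.add_apply]
    exact add_nonneg (hP e) (hQ e)
  mul_mem' {P Q} hP hQ e := by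
    rw [AddMonoidAlgebra.coeff_mul]
    refine Finset.sum_nonneg fun a _ => Finset.sum_nonneg fun b _ => ?_
    dsimp only
    split_ifs
    exacts [mul_nonneg (hP a) (hQ b), le_rfl]

theorem qMonomial_mem_nonnegCone (e : ℚ) : qMonomial e 1 ∈ nonnegCone := by
  intro f
  rw [qMonomial, AddMonoidAlgebra.coeff_single, Finsupp.single_apply]
  split_ifs <;> norm_num

theorem ofPoly_gaussBinom_mem_nonnegCone (n k : ℕ) : ofPoly (gaussBinom n k) ∈ nonnegCone := by
  induction n generalizing k with
  | zero => cases k <;> simp [zero_mem, one_mem]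
  | succ n ih =>
    cases k with
    | zero => simp [one_mem]
    | succ k =>
      rw [gaussBinom_succ_succ, map_add, map_mul, ofPoly_X_pow]
      exact add_mem (ih k) (mul_mem (qMonomial_mem_nonnegCone _) (ih _))

theorem coeff_ofPoly (p : ℚ[X]) (k : ℕ) : (ofPoly p).coeff (k : ℚ) = p.coeff k := by
  induction p using Polynomial.induction_on' with
  | add p r hp hr =>
    rw [map_add, AddMonoidAlgebra.coeff_add, Finsupp.add_apply, hp, hr, Polynomial.coeff_add]
  | monomial n a =>
    rw [← C_mul_X_pow_eq_monomial, C_mul', map_smul, ofPoly_X_pow,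
      AddMonoidAlgebra.coeff_smul_apply, qMonomial, AddMonoidAlgebra.coeff_single,
      Finsupp.single_apply,
      Polynomial.coeff_smul, coeff_X_pow]
    simp [eq_comm]

theorem qNonneg_of_mem {P : QExpr} (hP : P ∈ nonnegCone) (hr : P ∈ ofPoly.range) :
    QNonneg P := by
  obtain ⟨p, rfl⟩ := hr
  exact ⟨p, rfl, fun k => coeff_ofPoly p k ▸ hP k⟩

/-! ### Recurrences for `G` -/

theorem ofPoly_X_pow_toNat_mul_qBinom (a b : ℤ) :
    ofPoly (X ^ b.toNat * qBinom a b) = qMonomial b 1 * ofPoly (qBinom a b) := by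
  rcases lt_or_ge b 0 with h | h
  · simp [qBinom_of_neg h]
  · have hb : ((b.toNat : ℕ) : ℚ) = (b : ℚ) := by exact_mod_cast Int.toNat_of_nonneg h
    rw [map_mul, ofPoly_X_pow, hb]

theorem GTerm_pascal {N M : ℤ} (h : 1 ≤ N + M) (α β : ℚ) (K j : ℤ) :
    GTerm N M α β K j
      = GTerm (N - 1) M α β K j + qMonomial N 1 * GTerm N (M - 1) (α - 1) (β + 1) K j := by
  unfold GTerm
  rw [qBinom_pascal h, map_add, ofPoly_X_pow_toNat_mul_qBinom, mul_add, ← mul_assoc, ← mul_assoc,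
    qMonomial_mul_qMonomial, qMonomial_mul_qMonomial, show N - 1 + M = N + M - 1 by ring,
    show N + (M - 1) = N + M - 1 by ring, show N - 1 - K * j = N - K * j - 1 by ring, mul_one,
    one_mul]
  congr 3
  push_cast
  ring

/-- The rule `qBinom_pascal` turns the extra factor `q^{N - K j}` into a shift of `α` and `β`. -/
theorem G_pascal {N M K : ℤ} (h : 1 ≤ N + M) (hK : K ≠ 0) (α β : ℚ) :
    G N M α β K = G (N - 1) M α β K + qMonomial N 1 * G N (M - 1) (α - 1) (β + 1) K := by
  unfold G
  rw [mul_finsum, ← finsum_add_distrib (GTerm_support_finite _ _ _ _ _ hK)]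
  · exact finsum_congr fun j => GTerm_pascal h α β K j
  · refine (GTerm_support_finite N (M - 1) (α - 1) (β + 1) K hK).subset fun j hj => ?_
    exact right_ne_zero_of_mul hj

theorem G_symm (N M : ℤ) (α β : ℚ) (K : ℤ) : G N M α β K = G M N β α K := by
  unfold G
  rw [← finsum_comp_equiv (Equiv.neg ℤ)]
  refine finsum_congr fun j => ?_
  unfold GTerm
  rw [← qBinom_symm (N + M), add_comm M N, Equiv.neg_apply,
    show N + M - (N - K * -j) = M - K * j by ring]
  congr 2
  · push_cast; ring
  · simp [zpow_neg, ← inv_zpow]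

theorem G_pascal' {N M K : ℤ} (h : 1 ≤ N + M) (hK : K ≠ 0) (α β : ℚ) :
    G N M α β K = G N (M - 1) α β K + qMonomial M 1 * G (N - 1) M (α + 1) (β - 1) K := by
  rw [G_symm, G_pascal (by omega) hK, G_symm (M - 1), G_symm M]

/-- The substitution `j ↦ 1 - j` changes the sign of the sum. -/
theorem G_zero_left_eq_zero {N M K : ℤ} (h : N - M = K) (β : ℚ) :
    G N M 0 β K = 0 := by
  have key : G N M 0 β K = -G N M 0 β K := by
    unfold G
    rw [← finsum_neg_distrib]
    nth_rewrite 1 [← finsum_comp_equiv (Equiv.subLeft (1 : ℤ))]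
    refine finsum_congr fun j => ?_
    unfold GTerm
    rw [← qBinom_symm (N + M), Equiv.subLeft_apply,
      show N + M - (N - K * (1 - j)) = N - K * j by rw [← h]; ring, ← neg_mul]
    congr 1
    rw [qMonomial, qMonomial, ← AddMonoidAlgebra.single_neg]
    congr 1
    · push_cast; ring
    · rw [zpow_sub₀ (by norm_num), zpow_one, div_eq_mul_inv, ← inv_zpow]; norm_num
  ext e
  have h := DFunLike.congr_fun (congrArg AddMonoidAlgebra.coeff key) e
  rw [AddMonoidAlgebra.coeff_neg, Finsupp.neg_apply] at h
  rw [AddMonoidAlgebra.coeff_zero, Finsupp.zero_apply]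
  linarith

theorem G_eq_zero_of_neg {N M : ℤ} (h : N + M < 0) (α β : ℚ) (K : ℤ) : G N M α β K = 0 := by
  refine (finsum_congr fun j => ?_).trans finsum_zero
  rw [GTerm, qBinom, if_neg (by omega), map_zero, mul_zero]

/-- Only the term `j = 0` can be nonzero. -/
theorem G_mem_of_add_eq_zero {N M K : ℤ} (h : N + M = 0) (hNM : |N - M| ≤ K) (hK : K ≠ 0)
    (α β : ℚ) : G N M α β K ∈ nonnegCone := by
  have hz : ∀ j, j ≠ 0 → GTerm N M α β K j = 0 := by
    intro j hj
    rw [GTerm, qBinom, if_neg, map_zero, mul_zero]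
    rintro ⟨h1, h2⟩
    have h3 : N = K * j := by linarith
    have h4 : K ≤ |K * j| := by
      rw [abs_mul]
      exact (le_abs_self K).trans (le_mul_of_one_le_right (abs_nonneg K) (Int.one_le_abs hj))
    have h5 : |N - M| = 2 * |K * j| := by
      rw [← h3, show N - M = 2 * N by linarith, abs_mul]; norm_num
    have := abs_nonneg (N - M)
    omega
  rw [G, finsum_eq_single _ 0 hz, GTerm]
  refine mul_mem ?_ ?_
  · rw [zpow_zero]; exact qMonomial_mem_nonnegCone _
  · rw [h, mul_zero, sub_zero, qBinom]
    split_ifs with hN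
    · rw [show N = 0 by omega]
      simp [one_mem]
    · simp [zero_mem]

/-- The `q`-Pascal recurrences close up on the parameter pairs `(1, 1)`, `(0, 2)` and `(2, 0)`,
because the one term that would leave the admissible range of `N - M` vanishes. -/
theorem G_mem_of_add_eq_two {K : ℤ} (hK : 2 ≤ K) (s : ℕ) : ∀ N M : ℤ, N + M ≤ s →
    (|N - M| ≤ K - 1 → G N M 1 1 K ∈ nonnegCone) ∧
    (2 - K ≤ N - M → N - M ≤ K → G N M 0 2 K ∈ nonnegCone) := by
  have hK0 : K ≠ 0 := by omega
  induction s with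
  | zero =>
    intro N M h
    rcases lt_or_eq_of_le h with h | h
    · simp only [G_eq_zero_of_neg h, zero_mem, implies_true, and_self]
    · exact ⟨fun h1 => G_mem_of_add_eq_zero h (by omega) hK0 _ _,
        fun h1 h2 => G_mem_of_add_eq_zero h (abs_le.mpr ⟨by omega, h2⟩) hK0 _ _⟩
  | succ s ih =>
    intro N M h
    rcases lt_or_ge (N + M) 1 with h0 | h0
    · exact ih N M (by omega)
    -- For `N < M` the case `(1, 1)` follows by exchanging `N` and `M`.
    have large : ∀ N M : ℤ, N + M ≤ (s + 1 : ℕ) → 1 ≤ N + M → M ≤ N → |N - M| ≤ K - 1 →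
        G N M 1 1 K ∈ nonnegCone := by
      intro N M h h0 hMN h1
      have h1' := abs_le.mp h1
      rw [G_pascal h0 hK0]
      refine add_mem ((ih (N - 1) M (by omega)).1 (abs_le.mpr ⟨by omega, by omega⟩))
        (mul_mem (qMonomial_mem_nonnegCone _) ?_)
      have := (ih N (M - 1) (by omega)).2 (by omega) (by omega)
      norm_num
      exact this
    refine ⟨fun h1 => ?_, fun h1 h2 => ?_⟩
    · rcases le_total M N with hMN | hMN
      · exact large N M h h0 hMN h1
      · rw [G_symm]
        exact large M N (by omega) (by omega) hMN (by rwa [abs_sub_comm])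
    · rcases eq_or_lt_of_le h2 with h3 | h3
      · rw [G_zero_left_eq_zero h3]
        exact zero_mem _
      · rw [G_pascal' h0 hK0]
        refine add_mem ((ih N (M - 1) (by omega)).2 (by omega) (by omega))
          (mul_mem (qMonomial_mem_nonnegCone _) ?_)
        have := (ih (N - 1) M (by omega)).1 (abs_le.mpr ⟨by omega, by omega⟩)
        norm_num
        exact this

theorem G_one_one_mem {N M K : ℤ} (hK : 2 ≤ K) (h : |N - M| ≤ K - 1) :
    G N M 1 1 K ∈ nonnegCone :=
  (G_mem_of_add_eq_two hK (N + M).toNat N M (by omega)).1 h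

/-! ### The positivity-preserving transformation -/

/-- The coefficient of `[k choose (k - x) / 2]` in the expansion of `q^{x² / 2} [2L choose L - x]`;
it does not depend on `x`. -/
noncomputable def transformCoeff (L k : ℕ) : QExpr :=
  ∑ m ∈ range (L + 1), qMonomial (((m : ℚ) ^ 2 + ((m : ℚ) + k) ^ 2) / 2) 1
    * ofPoly (gaussBinom L (m + k) * gaussBinom (m + k) m)

theorem transformCoeff_mem_nonnegCone (L k : ℕ) : transformCoeff L k ∈ nonnegCone :=
  sum_mem fun m _ => mul_mem (qMonomial_mem_nonnegCone _) (by
    rw [map_mul]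
    exact mul_mem (ofPoly_gaussBinom_mem_nonnegCone _ _) (ofPoly_gaussBinom_mem_nonnegCone _ _))

theorem transformCoeff_eq_zero_of_lt {L k : ℕ} (h : L < k) : transformCoeff L k = 0 :=
  Finset.sum_eq_zero fun m _ => by simp [gaussBinom_eq_zero_of_lt (by omega : L < m + k)]

/-- The `q`-binomial coefficient `[k choose (k - x) / 2]`, understood as `0` if `k - x` is odd. -/
noncomputable def centralBinom (k : ℕ) (x : ℤ) : QExpr :=
  if (2 : ℤ) ∣ k - x then ofPoly (qBinom k ((k - x) / 2)) else 0

theorem centralBinom_neg (k : ℕ) (x : ℤ) : centralBinom k (-x) = centralBinom k x := by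
  unfold centralBinom
  by_cases h : (2 : ℤ) ∣ k - x
  · rw [if_pos h, if_pos (by omega), ← qBinom_symm,
      show (k : ℤ) - (k - -x) / 2 = (k - x) / 2 by omega]
  · rw [if_neg h, if_neg (by omega)]

theorem centralBinom_eq_zero_of_not {k x : ℕ} (h : ∀ t, k ≠ x + 2 * t) :
    centralBinom k x = 0 := by
  unfold centralBinom
  split_ifs with h2
  · rw [qBinom_of_neg, map_zero]
    have := h ((k - x) / 2)
    omega
  · rfl

theorem centralBinom_add_two_mul (x t : ℕ) :
    centralBinom (x + 2 * t) x = ofPoly (gaussBinom (x + 2 * t) t) := by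
  rw [centralBinom, if_pos (by omega), ← qBinom_natCast]
  congr 2
  omega

theorem transform_natCast (L x : ℕ) :
    qMonomial ((x : ℚ) ^ 2 / 2) 1 * ofPoly (qBinom (2 * L) (L - x))
      = ∑ k ∈ range (L + 1), transformCoeff L k * centralBinom k x := by
  rcases lt_or_ge L x with h | hx
  · rw [qBinom_of_neg (by omega), map_zero, mul_zero]
    refine (Finset.sum_eq_zero fun k hk => ?_).symm
    rw [centralBinom_eq_zero_of_not (by have := mem_range.mp hk; omega), mul_zero]
  have reindex : ∑ k ∈ range (L + 1), transformCoeff L k * centralBinom k x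
      = ∑ t ∈ range (L + 1), transformCoeff L (x + 2 * t)
          * ofPoly (gaussBinom (x + 2 * t) t) := by
    rw [Finset.sum_subset (range_subset_range.mpr (by omega : L + 1 ≤ x + 2 * L + 1))
      fun k _ hk => by
        rw [transformCoeff_eq_zero_of_lt (by simpa using hk), zero_mul]]
    refine (Finset.sum_of_injOn (fun t => x + 2 * t) ?_ ?_ ?_ ?_).symm
    · intro a _ b _ h
      simpa using h
    · intro t ht
      simp only [coe_range, Set.mem_Iio] at ht ⊢
      omega
    · intro k hk hk'
      rw [centralBinom_eq_zero_of_not, mul_zero]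
      rintro t rfl
      refine hk' ⟨t, ?_, rfl⟩
      simp only [coe_range, Set.mem_Iio, mem_range] at hk ⊢
      omega
    · intro t _
      rw [centralBinom_add_two_mul]
  rw [reindex, show (2 * L : ℤ) = ((L + L : ℕ) : ℤ) by push_cast; ring,
    show (L : ℤ) - x = ((L - x : ℕ) : ℤ) by omega, qBinom_natCast, gaussBinom_double_eq_sum L x hx,
    map_sum, Finset.mul_sum]
  refine Finset.sum_congr rfl fun t _ => ?_
  rw [map_sum, Finset.mul_sum, transformCoeff, Finset.sum_mul]
  refine Finset.sum_congr rfl fun m _ => ?_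
  have hexp : qMonomial (((m : ℚ) ^ 2 + ((m : ℚ) + (x + 2 * t : ℕ)) ^ 2) / 2) 1
      = qMonomial ((x : ℚ) ^ 2 / 2) 1
        * ofPoly (X ^ (m ^ 2 + m * x + 2 * m * t + 2 * t ^ 2 + 2 * t * x)) := by
    rw [ofPoly_X_pow, qMonomial_mul_qMonomial, one_mul]
    congr 1
    push_cast
    ring
  rw [hexp]
  simp only [map_mul]
  ring

theorem transform (L : ℕ) (x : ℤ) :
    qMonomial ((x : ℚ) ^ 2 / 2) 1 * ofPoly (qBinom (2 * L) (L - x))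
      = ∑ k ∈ range (L + 1), transformCoeff L k * centralBinom k x := by
  obtain ⟨y, rfl | rfl⟩ := x.eq_nat_or_neg
  · rw [Int.cast_natCast]
    exact transform_natCast L y
  · have h := transform_natCast L y
    rw [← qBinom_symm, show (2 * L : ℤ) - (L - y) = L - -y by ring] at h
    simp only [centralBinom_neg]
    rw [← h]
    congr 2
    push_cast
    ring

/-- The transformation applied to each term of `G`. It doubles `K` and replaces `(α, β)` by
`(α / 2 + K + d, β / 2 + K - d)`, where `d = M - N`. -/
theorem G_transform (L : ℕ) (d : ℤ) (α β : ℚ) {K : ℤ} (hK : K ≠ 0) :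
    qMonomial ((d : ℚ) ^ 2 / 2) 1
        * G (L - d) (L + d) (α / 2 + K + d) (β / 2 + K - d) (2 * K)
      = ∑ k ∈ range (L + 1), transformCoeff L k *
          if (2 : ℤ) ∣ k - d then G ((k - d) / 2) ((k + d) / 2) α β K else 0 := by
  have hterm : ∀ j : ℤ, qMonomial ((d : ℚ) ^ 2 / 2) 1
        * GTerm (L - d) (L + d) (α / 2 + K + d) (β / 2 + K - d) (2 * K) j
      = ∑ k ∈ range (L + 1), transformCoeff L k *
          if (2 : ℤ) ∣ k - d then GTerm ((k - d) / 2) ((k + d) / 2) α β K j else 0 := by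
    intro j
    have h := congrArg
      (fun P => qMonomial ((K : ℚ) * j * (((α + β) * j + (α - β)) / 2)) ((-1) ^ j) * P)
      (transform L (d + 2 * K * j))
    simp only [← mul_assoc, qMonomial_mul_qMonomial] at h
    rw [GTerm, ← mul_assoc, qMonomial_mul_qMonomial, show (L : ℤ) - d + (L + d) = 2 * L by ring,
      show (L : ℤ) - d - 2 * K * j = L - (d + 2 * K * j) by ring]
    refine Eq.trans ?_ (h.trans ?_)
    · congr 2
      · push_cast; ring
      · ring
    · rw [Finset.mul_sum]
      refine Finset.sum_congr rfl fun k _ => ?_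
      rw [mul_left_comm, centralBinom]
      congr 1
      have hpar : (2 : ℤ) ∣ k - (d + 2 * K * j) ↔ (2 : ℤ) ∣ k - d := by
        rw [show (k : ℤ) - (d + 2 * K * j) = k - d - 2 * (K * j) by ring]
        exact dvd_sub_left (dvd_mul_right 2 (K * j))
      by_cases h2 : (2 : ℤ) ∣ k - d
      · rw [if_pos h2, if_pos (hpar.mpr h2), GTerm,
          show ((k : ℤ) - d) / 2 + (k + d) / 2 = k by omega,
          show ((k : ℤ) - (d + 2 * K * j)) / 2 = (k - d) / 2 - K * j by
            rw [show (k : ℤ) - (d + 2 * K * j) = k - d - 2 * (K * j) by ring]; omega]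
      · rw [if_neg h2, if_neg (fun h => h2 (hpar.mp h)), mul_zero]
  unfold G
  rw [mul_finsum, finsum_congr hterm,
    finsum_sum_comm]
  · refine Finset.sum_congr rfl fun k _ => ?_
    split_ifs
    · rw [mul_finsum]
    · simp
  · intro k _
    refine (GTerm_support_finite ((k - d) / 2) ((k + d) / 2) α β K hK).subset fun j hj => ?_
    have := right_ne_zero_of_mul hj
    simp only [ne_eq, ite_eq_right_iff, not_forall] at this
    exact this.2

theorem G_transform_mem (L : ℕ) (d : ℤ) (α β : ℚ) {K : ℤ} (hK : K ≠ 0)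
    (h : ∀ N M : ℤ, M - N = d → G N M α β K ∈ nonnegCone) :
    G (L - d) (L + d) (α / 2 + K + d) (β / 2 + K - d) (2 * K) ∈ nonnegCone := by
  have h1 : G (L - d) (L + d) (α / 2 + K + d) (β / 2 + K - d) (2 * K)
      = qMonomial (-((d : ℚ) ^ 2 / 2)) 1 * ∑ k ∈ range (L + 1), transformCoeff L k *
          if (2 : ℤ) ∣ k - d then G ((k - d) / 2) ((k + d) / 2) α β K else 0 := by
    rw [← G_transform L d α β hK, ← mul_assoc, qMonomial_mul_qMonomial, neg_add_cancel, one_mul,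
      qMonomial_zero_one, one_mul]
  rw [h1]
  refine mul_mem (qMonomial_mem_nonnegCone _) (sum_mem fun k _ =>
    mul_mem (transformCoeff_mem_nonnegCone L k) ?_)
  split_ifs
  · exact h _ _ (by omega)
  · exact zero_mem _

/-! ### Iteration of the transformation -/

/-- With `c_n = 2 (2^n - 2^{-n}) / 3` one has `c_n / 2 + 2^n = c_{n+1}`, so that one application of
the transformation takes the parameters for `n` to those for `n + 1`. -/
theorem G_iterate_mem {v Δ : ℤ} (hv : 2 ≤ v) (hΔ : 0 ≤ Δ) (hΔv : Δ < v) (n : ℕ) :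
    ∀ N M : ℤ, M - N = 2 ^ n * Δ →
      G N M
        (2 * (((2 : ℚ) ^ n - ((2 : ℚ) ^ n)⁻¹) / 3) * ((v : ℚ) + (Δ : ℚ)) + ((2 : ℚ) ^ n)⁻¹)
        (2 * (((2 : ℚ) ^ n - ((2 : ℚ) ^ n)⁻¹) / 3) * ((v : ℚ) - (Δ : ℚ)) + ((2 : ℚ) ^ n)⁻¹)
        (2 ^ n * v) ∈ nonnegCone := by
  induction n with
  | zero =>
    intro N M h
    simp only [pow_zero, one_mul, inv_one, sub_self, zero_div, mul_zero, zero_mul, zero_add] at h ⊢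
    exact G_one_one_mem hv (abs_le.mpr ⟨by omega, by omega⟩)
  | succ n ih =>
    intro N M h
    rcases lt_or_ge (N + M) 0 with h0 | h0
    · rw [G_eq_zero_of_neg h0]
      exact zero_mem _
    rw [pow_succ] at h
    obtain ⟨L, hL⟩ : ∃ L : ℕ, N + M = 2 * L := ⟨((N + M) / 2).toNat, by grind⟩
    have hK : (2 : ℤ) ^ n * v ≠ 0 := mul_ne_zero (by positivity) (by omega)
    have key := G_transform_mem L (2 ^ n * Δ) _ _ hK ih
    have hp : (2 : ℚ) ^ n ≠ 0 := by positivity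
    convert key using 1
    congr 1
    · linarith
    · linarith
    · push_cast
      rw [pow_succ]
      field_simp
      ring
    · push_cast
      rw [pow_succ]
      field_simp
      ring
    · ring

/-- The exponents are non-negative integers: `(4 ^ n - 1) / 3` is a natural number `c` and the
exponent of the `j`-th term is `v j² + 2 c v j (v j + Δ)`, where `j (v j + Δ) ≥ 0` as `|Δ| ≤ v`. -/
theorem G_iterate_mem_range {v Δ : ℤ} (hv : 0 ≤ v) (hΔ : |Δ| ≤ v) (N M : ℤ) (n : ℕ) :
    G N M
        (2 * (((2 : ℚ) ^ n - ((2 : ℚ) ^ n)⁻¹) / 3) * ((v : ℚ) + (Δ : ℚ)) + ((2 : ℚ) ^ n)⁻¹)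
        (2 * (((2 : ℚ) ^ n - ((2 : ℚ) ^ n)⁻¹) / 3) * ((v : ℚ) - (Δ : ℚ)) + ((2 : ℚ) ^ n)⁻¹)
        (2 ^ n * v) ∈ ofPoly.range := by
  obtain ⟨c, hc⟩ : ∃ c : ℕ, 4 ^ n = 3 * c + 1 := by
    induction n with
    | zero => exact ⟨0, rfl⟩
    | succ n ih =>
      obtain ⟨c, hc⟩ := ih
      exact ⟨4 * c + 1, by rw [pow_succ, hc]; ring⟩
  refine finsum_induction (· ∈ ofPoly.range) (zero_mem _) (fun _ _ => add_mem) fun j => ?_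
  have hj : 0 ≤ j * (v * j + Δ) := by
    have h1 : |j| ≤ |j| * |j| := by
      rcases eq_or_ne j 0 with rfl | h
      · simp
      · exact le_mul_of_one_le_left (abs_nonneg j) (Int.one_le_abs h)
    have h2 : -(j * Δ) ≤ |j| * v :=
      (neg_le_abs _).trans ((abs_mul j Δ).le.trans (mul_le_mul_of_nonneg_left hΔ (abs_nonneg j)))
    have h3 : |j| * |j| = j * j := abs_mul_abs_self j
    nlinarith [mul_le_mul_of_nonneg_right h1 hv]
  obtain ⟨e, he⟩ : ∃ e : ℕ, (e : ℤ) = v * j ^ 2 + 2 * c * v * (j * (v * j + Δ)) :=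
    ⟨_, Int.toNat_of_nonneg (by positivity)⟩
  have hexp : ((2 ^ n * v : ℤ) : ℚ) * j *
      (((2 * (((2 : ℚ) ^ n - ((2 : ℚ) ^ n)⁻¹) / 3) * ((v : ℚ) + Δ) + ((2 : ℚ) ^ n)⁻¹
          + (2 * (((2 : ℚ) ^ n - ((2 : ℚ) ^ n)⁻¹) / 3) * ((v : ℚ) - Δ) + ((2 : ℚ) ^ n)⁻¹)) * j
        + (2 * (((2 : ℚ) ^ n - ((2 : ℚ) ^ n)⁻¹) / 3) * ((v : ℚ) + Δ) + ((2 : ℚ) ^ n)⁻¹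
          - (2 * (((2 : ℚ) ^ n - ((2 : ℚ) ^ n)⁻¹) / 3) * ((v : ℚ) - Δ) + ((2 : ℚ) ^ n)⁻¹))) / 2)
      = (e : ℚ) := by
    have he' : (e : ℚ) = v * j ^ 2 + 2 * c * v * (j * (v * j + Δ)) := by exact_mod_cast he
    have hc' : (2 : ℚ) ^ n * 2 ^ n = 3 * c + 1 := by
      rw [← mul_pow]; norm_num; exact_mod_cast hc
    have hp : (2 : ℚ) ^ n * ((2 : ℚ) ^ n)⁻¹ = 1 := mul_inv_cancel₀ (by positivity)
    rw [he']
    push_cast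
    linear_combination (2 / 3 * v * j * (v * j + Δ)) * hc'
      + (v * j ^ 2 - 2 / 3 * v * j * (v * j + Δ)) * hp
  rw [GTerm, hexp, show qMonomial (e : ℚ) ((-1) ^ j) = ofPoly (((-1 : ℚ) ^ j) • X ^ e) by
    rw [map_smul, ofPoly_X_pow, qMonomial, qMonomial, AddMonoidAlgebra.smul_single, smul_eq_mul,
      mul_one]]
  exact mul_mem ⟨_, rfl⟩ ⟨_, rfl⟩

end BressoudG

theorem theoremT4p7 (n L : ℕ) (v Δ : ℤ) (hn : 1 ≤ n) (hv : 2 ≤ v) (hΔ : 0 ≤ Δ) (hΔv : Δ < v) :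
    BressoudG.QNonneg
      (BressoudG.G
        ((L : ℤ) - Δ * 2 ^ (n - 1))
        ((L : ℤ) + Δ * 2 ^ (n - 1))
        (2 * (((2 : ℚ) ^ n - ((2 : ℚ) ^ n)⁻¹) / 3) * ((v : ℚ) + (Δ : ℚ)) + ((2 : ℚ) ^ n)⁻¹)
        (2 * (((2 : ℚ) ^ n - ((2 : ℚ) ^ n)⁻¹) / 3) * ((v : ℚ) - (Δ : ℚ)) + ((2 : ℚ) ^ n)⁻¹)
        (2 ^ n * v)) := by
  refine BressoudG.qNonneg_of_mem
    (BressoudG.G_iterate_mem hv hΔ hΔv n _ _ ?_)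
    (BressoudG.G_iterate_mem_range (by omega) (abs_le.mpr ⟨by omega, by omega⟩) _ _ n)
  obtain ⟨m, rfl⟩ := Nat.exists_eq_add_of_le' hn
  rw [Nat.add_sub_cancel]
  ring
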